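/- Let $G$ be a finite simple circular-arc graph, that is, the intersection graph of a finite family of open arcs of a circle. Let $\mathrm{lpt}(G)$ be the minimum cardinality of a set of vertices of $G$ that intersects every longest path of $G$, and let $\mathrm{lct}(G)$ be the minimum cardinality of a set of vertices of $G$ that intersects every longest cycle of $G$. If $G$ is connected, then $\mathrm{lpt}(G)\le 3$, and if $G$ is $2$-connected, then $\mathrm{lct}(G)\le 3$. -/

import Mathlib

namespace SimpleGraph

universe u
variable {V : Type u}

/-- The open arc of the circle `ℝ / ℤ` that runs counterclockwise from the angle `a` to the
angle `b` (one full turn is `1`), for `a < b`. It is the whole circle if `b > a + 1`. -/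
def openArc (a b : ℝ) : Set UnitAddCircle :=
  (fun t : ℝ => (t : UnitAddCircle)) '' Set.Ioo a b

/-- `G` is a circular-arc graph: it is the intersection graph of a family of (nonempty) open arcs
of a circle. -/
def IsCircularArc (G : SimpleGraph V) : Prop :=
  ∃ a b : V → ℝ, (∀ v, a v < b v) ∧
    ∀ v w : V, G.Adj v w ↔ v ≠ w ∧ (openArc (a v) (b v) ∩ openArc (a w) (b w)).Nonempty

/-- `G` is `k`-connected: it has more than `k` vertices, and it remains connected whenever fewer
than `k` vertices are deleted. -/
def IsVertexConnected (G : SimpleGraph V) (k : ℕ) : Prop :=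
  (k : ℕ∞) < ENat.card V ∧ ∀ S : Set V, S.encard < k → (G.induce Sᶜ).Connected

/-- `p` is a path of `G` of largest length among all paths of `G`. -/
def IsLongestPath {G : SimpleGraph V} {v w : V} (p : G.Walk v w) : Prop :=
  p.IsPath ∧ ∀ (x y : V) (q : G.Walk x y), q.IsPath → q.length ≤ p.length

/-- `c` is a cycle of `G` of largest length among all cycles of `G`. -/
def IsLongestCycle {G : SimpleGraph V} {v : V} (c : G.Walk v v) : Prop :=
  c.IsCycle ∧ ∀ (x : V) (d : G.Walk x x), d.IsCycle → d.length ≤ c.length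

/-- `S` is a set of vertices that intersects every longest path of `G`. -/
def IsLongestPathTransversal (G : SimpleGraph V) (S : Set V) : Prop :=
  ∀ (v w : V) (p : G.Walk v w), IsLongestPath p → ∃ x ∈ S, x ∈ p.support

/-- `S` is a set of vertices that intersects every longest cycle of `G`. -/
def IsLongestCycleTransversal (G : SimpleGraph V) (S : Set V) : Prop :=
  ∀ (v : V) (c : G.Walk v v), IsLongestCycle c → ∃ x ∈ S, x ∈ c.support

/-- The minimum cardinality of a longest path transversal of `G`. -/
noncomputable def lpt (G : SimpleGraph V) : ℕ∞ :=
  ⨅ (S : Set V) (_ : G.IsLongestPathTransversal S), S.encard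

/-- The minimum cardinality of a longest cycle transversal of `G`. -/
noncomputable def lct (G : SimpleGraph V) : ℕ∞ :=
  ⨅ (S : Set V) (_ : G.IsLongestCycleTransversal S), S.encard

end SimpleGraph

/-! Let `u` be a longest arc. Cutting the circle along `u` leaves a segment on which every other arc
traces an interval. If a longest path or cycle avoids `u`, the arcs of its consecutive vertices meet
outside `u`, since otherwise `u` could be inserted between them; so its traces unite to an interval.
Longest paths pairwise meet in a connected graph, longest cycles in a 2-connected one, so by Helly
on the line these intervals share a point `t`. Among the arcs through `t`, let `y` start first and
`z` end last: then `{u, y, z}` is a transversal (`exists_transversal_of_normalized`). -/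

namespace SimpleGraph

universe u
variable {V : Type u}

/-! ### Cutting and gluing walks -/

namespace Walk

variable {G : SimpleGraph V} {u v w : V}

lemma exists_eq_append_cons_of_mem_darts {d : G.Dart} {p : G.Walk u v} (hd : d ∈ p.darts) :
    ∃ (q : G.Walk u d.fst) (r : G.Walk d.snd v), p = q.append (cons d.adj r) := by
  induction p with
  | nil => simp at hd
  | cons h p ih =>
    rw [darts_cons, List.mem_cons] at hd
    rcases hd with rfl | hd
    · exact ⟨nil, p, rfl⟩
    · obtain ⟨q, r, rfl⟩ := ih hd
      exact ⟨cons h q, r, rfl⟩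

lemma exists_mem_darts_of_mem_support {p : G.Walk u v} (hp : ¬ p.Nil) (hw : w ∈ p.support) :
    ∃ d ∈ p.darts, w = d.fst ∨ w = d.snd := by
  induction p with
  | nil => simp at hp
  | cons h p ih =>
    rw [support_cons, List.mem_cons] at hw
    rcases hw with rfl | hw
    · exact ⟨⟨(_, _), h⟩, by simp, Or.inl rfl⟩
    · by_cases hn : p.Nil
      · cases p with
        | nil => exact ⟨⟨(_, _), h⟩, by simp, Or.inr (by simpa using hw)⟩
        | cons => simp at hn
      · obtain ⟨d, hd, hwd⟩ := ih hn hw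
        exact ⟨d, by simp [hd], hwd⟩

lemma IsPath.append {p : G.Walk u v} {q : G.Walk v w} (hp : p.IsPath) (hq : q.IsPath)
    (h : ∀ x ∈ p.support, x ∈ q.support → x = v) : (p.append q).IsPath := by
  rw [isPath_def, support_append, List.nodup_append']
  have hq' := hq.support_nodup
  rw [← cons_tail_support, List.nodup_cons] at hq'
  refine ⟨hp.support_nodup, hq'.2, fun x hx hx' => ?_⟩
  have := h x hx (List.mem_of_mem_tail hx')
  subst this
  exact hq'.1 hx'

/-- A walk that meets `T` has a final segment that meets `T` in its first vertex only. -/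
lemma exists_last_mem (r : G.Walk u v) (T : Set V) :
    (∃ z ∈ T, ∃ q : G.Walk z v, q.IsPath ∧ q.support ⊆ r.support ∧
      ∀ x ∈ q.support, x ∈ T → x = z) ∨ ∀ x ∈ r.support, x ∉ T := by
  classical
  induction r with
  | nil =>
    rename_i u
    by_cases h : u ∈ T
    · exact Or.inl ⟨u, h, nil, by simp, by simp, by simp⟩
    · exact Or.inr (by simpa using h)
  | cons h p ih =>
    rename_i a b c
    rcases ih with ⟨z, hz, q, hq, hqp, hqT⟩ | ih
    · exact Or.inl ⟨z, hz, q, hq, fun x hx => by simp [hqp hx], hqT⟩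
    · by_cases ha : a ∈ T
      · refine Or.inl ⟨a, ha, (cons h p).bypass, bypass_isPath _, support_bypass_subset_support _,
          fun x hx hxT => ?_⟩
        have := support_bypass_subset_support _ hx
        rw [support_cons, List.mem_cons] at this
        exact this.resolve_right fun hx => ih x hx hxT
      · refine Or.inr fun x hx => ?_
        rw [support_cons, List.mem_cons] at hx
        rcases hx with rfl | hx
        · exact ha
        · exact ih x hx

/-- A walk from `A` to `B` contains a path from `A` to `B` with no inner vertex in `A ∪ B`. -/
lemma exists_isPath_between {A B : Set V} (r : G.Walk u v) (hu : u ∈ A) (hv : v ∈ B) :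
    ∃ x ∈ A, ∃ y ∈ B, ∃ q : G.Walk x y, q.IsPath ∧ q.support ⊆ r.support ∧
      (∀ z ∈ q.support, z ∈ A → z = x) ∧ ∀ z ∈ q.support, z ∈ B → z = y := by
  obtain ⟨x, hx, q, hq, hqr, hqA⟩ :=
    (r.exists_last_mem A).resolve_right fun h => h u r.start_mem_support hu
  obtain ⟨y, hy, s, hs, hsq, hsB⟩ :=
    (q.reverse.exists_last_mem B).resolve_right fun h => h v (by simp) hv
  have hsq' : s.support ⊆ q.support := by simpa using hsq
  exact ⟨x, hx, y, hy, s.reverse, hs.reverse, fun z hz => hqr (hsq' (by simpa using hz)),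
    fun z hz => hqA z (hsq' (by simpa using hz)), fun z hz => hsB z (by simpa using hz)⟩

lemma IsPath.exists_long_isPath_to {p : G.Walk u v} (hp : p.IsPath) (hw : w ∈ p.support) :
    ∃ (s : V) (q : G.Walk s w), q.IsPath ∧ q.support ⊆ p.support ∧ p.length ≤ 2 * q.length := by
  obtain ⟨q, r, rfl⟩ := p.mem_support_iff_exists_append.mp hw
  have hl := length_append q r
  rcases le_total q.length r.length with h | h
  · exact ⟨v, r.reverse, hp.of_append_right.reverse, fun x hx => by simp_all, by
      rw [length_reverse]; omega⟩
  · exact ⟨u, q, hp.of_append_left, fun x hx => by simp_all, by omega⟩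

lemma IsCycle.exists_long_isPath_between {c : G.Walk u u} (hc : c.IsCycle) (hv : v ∈ c.support)
    (hw : w ∈ c.support) (hvw : v ≠ w) :
    ∃ p : G.Walk v w, p.IsPath ∧ p.support ⊆ c.support ∧ c.length ≤ 2 * p.length := by
  classical
  have hc' := (isCycle_rotate hv).mpr hc
  have hlen : (c.rotate v hv).length = c.length := by simp
  have hsub : ∀ x, x ∈ (c.rotate v hv).support ↔ x ∈ c.support := fun x => by simp
  rw [← hlen]
  have hw' := (hsub w).mpr hw
  suffices ∃ p : G.Walk v w, p.IsPath ∧ (∀ x ∈ p.support, x ∈ (c.rotate v hv).support) ∧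
      (c.rotate v hv).length ≤ 2 * p.length by
    obtain ⟨p, hp, hpc, hl⟩ := this
    exact ⟨p, hp, fun x hx => (hsub x).mp (hpc x hx), hl⟩
  clear hsub hlen
  generalize c.rotate v hv = c' at *
  obtain ⟨q, r, rfl⟩ := c'.mem_support_iff_exists_append.mp hw'
  have hl := length_append q r
  rcases le_total q.length r.length with h | h
  · exact ⟨r.reverse, (hc'.isPath_of_append_right (not_nil_of_ne hvw)).reverse,
      fun x hx => by simp_all, by rw [length_reverse]; omega⟩
  · exact ⟨q, hc'.isPath_of_append_left (not_nil_of_ne hvw.symm),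
      fun x hx => by simp_all, by omega⟩

lemma iUnion_support_isPreconnected {X : Type*} [TopologicalSpace X] (I : V → Set X)
    (p : G.Walk u v) (hI : ∀ x, IsPreconnected (I x))
    (hp : ∀ d ∈ p.darts, (I d.fst ∩ I d.snd).Nonempty) :
    IsPreconnected (⋃ x ∈ p.support, I x) := by
  induction p with
  | nil => simpa using hI _
  | cons h p ih =>
    rename_i a b c
    have hsplit : (⋃ x ∈ (cons h p).support, I x) = I a ∪ ⋃ x ∈ p.support, I x := by
      simp [Set.iUnion_or, Set.iUnion_union_distrib]
    rw [hsplit]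
    obtain ⟨t, ht, ht'⟩ := hp ⟨(a, b), h⟩ (by simp)
    exact IsPreconnected.union t ht (Set.mem_biUnion p.start_mem_support ht') (hI a)
      (ih fun d hd => hp d (by simp [hd]))

/-- No vertex outside `p` is adjacent to both ends of an edge of `p`. -/
def IsSaturated (p : G.Walk u v) : Prop :=
  ∀ d ∈ p.darts, ∀ x, G.Adj x d.fst → G.Adj x d.snd → x ∈ p.support

end Walk

open Walk

variable {G : SimpleGraph V}

/-! ### Saturation of longest paths and cycles -/

lemma IsLongestPath.isSaturated {v w : V} {p : G.Walk v w} (hp : IsLongestPath p) :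
    p.IsSaturated := by
  intro d hd x h₁ h₂
  by_contra hx
  obtain ⟨q, r, rfl⟩ := exists_eq_append_cons_of_mem_darts hd
  have hlen := hp.2 _ _ (q.append (cons h₁.symm (cons h₂ r))) (by
    have := hp.1
    simp only [mem_support_append_iff, support_cons, List.mem_cons, not_or] at hx
    simp only [isPath_def, support_append, support_cons, List.tail_cons] at this ⊢
    have hx' : x ∉ r.support := hx.2.2
    simp only [List.nodup_append', List.nodup_cons, List.disjoint_cons_right] at this ⊢
    exact ⟨this.1, ⟨hx', this.2.1⟩, hx.1, this.2.2⟩)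
  simp at hlen

lemma IsLongestCycle.isSaturated {v : V} {c : G.Walk v v} (hc : IsLongestCycle c) :
    c.IsSaturated := by
  intro d hd x h₁ h₂
  by_contra hx
  obtain ⟨q, r, rfl⟩ := exists_eq_append_cons_of_mem_darts hd
  have hrq : (r.append q).IsPath := by
    have := hc.1.support_nodup
    rw [tail_support_append, support_cons, List.tail_cons] at this
    rw [isPath_def, support_append]
    exact List.perm_append_comm.nodup_iff.mp this
  have hx' : x ∉ (r.append q).support := by
    simp only [mem_support_append_iff, support_cons, List.mem_cons, not_or] at hx ⊢
    exact ⟨hx.2.2, hx.1⟩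
  have hnd := hrq.support_nodup
  rw [← cons_tail_support, List.nodup_cons] at hnd
  have hlen := hc.2 _ ((cons h₁.symm (cons h₂ nil)).append (r.append q)) (by
    refine IsPath.isCycle_append ?_ hrq ?_ (Or.inl (by simp))
    · simp [isPath_def, h₁.ne', h₂.ne, d.adj.ne]
    · intro y hy hy'
      simp only [support_cons, support_nil, List.tail_cons, List.mem_cons, List.not_mem_nil,
        or_false] at hy
      rcases hy with rfl | rfl
      · exact hx' (List.mem_of_mem_tail hy')
      · exact hnd.1 hy')
  simp at hlen
  omega

/-! ### Longest paths, and longest cycles, pairwise meet -/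

/-- If disjoint, the longer halves of `p` and `q`, joined by a connecting path, would form a path
longer than one of them. -/
lemma IsLongestPath.exists_mem_support_of_connected (hG : G.Connected) {a b c d : V}
    {p : G.Walk a b} {q : G.Walk c d} (hp : IsLongestPath p) (hq : IsLongestPath q) :
    ∃ x, x ∈ p.support ∧ x ∈ q.support := by
  by_contra! hdisj
  obtain ⟨r⟩ := hG.preconnected a c
  obtain ⟨x, hx, y, hy, s, hs, -, hsA, hsB⟩ := r.exists_isPath_between
    (A := {z | z ∈ p.support}) (B := {z | z ∈ q.support}) p.start_mem_support q.start_mem_support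
  obtain ⟨e, p', hp', hpp, hlp⟩ := hp.1.exists_long_isPath_to hx
  obtain ⟨f, q', hq', hqq, hlq⟩ := hq.1.exists_long_isPath_to hy
  have hne : x ≠ y := fun h => hdisj x hx (h ▸ hy)
  have h1 : (p'.append s).IsPath := hp'.append hs fun z hz hz' => hsA z hz' (hpp hz)
  have h2 : ((p'.append s).append q'.reverse).IsPath := by
    refine h1.append hq'.reverse fun z hz hz' => ?_
    rw [support_reverse, List.mem_reverse] at hz'
    rcases (mem_support_append_iff ..).mp hz with hz | hz
    · exact (hdisj z (hpp hz) (hqq hz')).elim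
    · exact hsB z hz (hqq hz')
  have hl1 := hp.2 _ _ _ h2
  have hl2 := hq.2 _ _ _ h2
  have hs0 : 0 < s.length := not_nil_iff_lt_length.mp (not_nil_of_ne hne)
  simp only [length_append, length_reverse] at hl1 hl2
  omega

lemma IsVertexConnected.exists_walk_avoiding (hG : G.IsVertexConnected 2) {v x y : V}
    (hx : x ≠ v) (hy : y ≠ v) : ∃ r : G.Walk x y, v ∉ r.support := by
  have hc := hG.2 {v} (by simp)
  obtain ⟨r⟩ := hc.preconnected ⟨x, hx⟩ ⟨y, hy⟩
  refine ⟨r.map (Embedding.induce _).toHom, ?_⟩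
  intro h
  obtain ⟨z, -, hz⟩ := List.mem_map.mp ((Walk.support_map (Embedding.induce _).toHom r) ▸ h)
  exact z.2 hz

/-- Two paths from `A` to `v` and a path from `A` to `w` that avoids `v` can be rearranged into
disjoint paths from `A` to `v` and from `A` to `w`. -/
lemma exists_disjoint_paths_of_fan {A : Set V} {a s t v w : V} (ha : a ∈ A) (hs : s ∈ A)
    (ht : t ∈ A) {r : G.Walk a w} (hr : v ∉ r.support) {p : G.Walk s v} {q : G.Walk t v}
    (hp : p.IsPath) (hq : q.IsPath) (hpq : ∀ x ∈ p.support, x ∈ q.support → x = v) :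
    ∃ s ∈ A, ∃ t ∈ A, ∃ (p : G.Walk s w) (q : G.Walk t v), p.IsPath ∧ q.IsPath ∧
      ∀ x ∈ p.support, x ∉ q.support := by
  classical
  have key : ∀ {s t z : V} (hs : s ∈ A) (ht : t ∈ A) {p : G.Walk s v} {q : G.Walk t v}
      (hp : p.IsPath) (hq : q.IsPath) (hpq : ∀ x ∈ p.support, x ∈ q.support → x = v)
      (r' : G.Walk z w) (hr' : r'.IsPath) (hv : v ∉ r'.support)
      (hz : ∀ x ∈ r'.support, x ∈ p.support ∨ x ∈ q.support → x = z) (hzp : z ∈ p.support),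
      ∃ s ∈ A, ∃ t ∈ A, ∃ (p : G.Walk s w) (q : G.Walk t v), p.IsPath ∧ q.IsPath ∧
        ∀ x ∈ p.support, x ∉ q.support := by
    intro s t z hs ht p q hp hq hpq r' hr' hv hz hzp
    have hsub := p.support_takeUntil_subset_support hzp
    have hzv : v ≠ z := fun h => hv (h ▸ r'.start_mem_support)
    refine ⟨s, hs, t, ht, (p.takeUntil z hzp).append r', q,
      (hp.takeUntil hzp).append hr' fun x hx hx' => hz x hx' (Or.inl (hsub hx)), hq,
      fun x hx hxq => ?_⟩
    rcases (mem_support_append_iff ..).mp hx with hx | hx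
    · have := hpq x (hsub hx) hxq
      subst this
      exact endpoint_notMem_support_takeUntil hp hzp hzv hx
    · have := hz x hx (Or.inr hxq)
      subst this
      exact hzv (hpq x hzp hxq).symm
  -- Leave the fan where `r` last meets it: the path hit there is diverted to `w`, the other still
  -- ends at `v`.
  rcases r.exists_last_mem {x | x ∈ p.support ∨ x ∈ q.support} with
    ⟨z, hz, r', hr', hrr, hT⟩ | h
  · rcases hz with hz | hz
    · exact key hs ht hp hq hpq r' hr' (fun h => hr (hrr h)) hT hz
    · exact key ht hs hq hp (fun x hx hx' => hpq x hx' hx) r' hr' (fun h => hr (hrr h))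
        (fun x hx hx' => hT x hx hx'.symm) hz
  · exact ⟨a, ha, t, ht, r.bypass, q, bypass_isPath _, hq, fun x hx hxq =>
      h x (support_bypass_subset_support _ hx) (Or.inr hxq)⟩

/-- Induction along a walk from `v` to `A`: a fan at the next vertex is rerouted, and its unchanged
end is extended by one edge. If `v ∈ A`, both paths may be trivial, so `s = t` is allowed. -/
lemma IsVertexConnected.exists_fan (hG : G.IsVertexConnected 2) {A : Set V} (hA : A.Nontrivial)
    (v : V) : ∃ s ∈ A, ∃ t ∈ A, ∃ (p : G.Walk s v) (q : G.Walk t v), p.IsPath ∧ q.IsPath ∧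
      ∀ x ∈ p.support, x ∈ q.support → x = v := by
  obtain ⟨a, ha, hav⟩ := hA.exists_ne v
  obtain ⟨b, hb, hba⟩ := hA.exists_ne a
  obtain ⟨r, -⟩ := hG.exists_walk_avoiding hav.symm hba
  clear hav hba ha
  induction r with
  | nil => exact ⟨_, hb, _, hb, nil, nil, by simp, by simp, by simp⟩
  | cons h r ih =>
    rename_i w v b
    obtain ⟨s, hs, t, ht, p, q, hp, hq, hpq⟩ := ih hb
    obtain ⟨a, ha, hav⟩ := hA.exists_ne v
    obtain ⟨r, hr⟩ := hG.exists_walk_avoiding hav h.ne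
    obtain ⟨s, hs, t, ht, p, q, hp, hq, hpq⟩ := exists_disjoint_paths_of_fan ha hs ht hr hp hq hpq
    have hwq := hpq w p.end_mem_support
    refine ⟨s, hs, t, ht, p, q.concat h.symm, hp, hq.concat hwq _, fun x hx hx' => ?_⟩
    rw [support_concat, List.mem_append, List.mem_singleton] at hx'
    exact hx'.resolve_left (hpq x hx)

/-- Menger's theorem for two paths: a fan at `d ∈ B` is rerouted to end at both `d` and `e`, then
trimmed. -/
lemma IsVertexConnected.exists_disjoint_paths (hG : G.IsVertexConnected 2) {A B : Set V}
    (hA : A.Nontrivial) (hB : B.Nontrivial) :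
    ∃ a₁ ∈ A, ∃ a₂ ∈ A, ∃ b₁ ∈ B, ∃ b₂ ∈ B, ∃ (p : G.Walk a₁ b₁) (q : G.Walk a₂ b₂),
      p.IsPath ∧ q.IsPath ∧ (∀ x ∈ p.support, x ∉ q.support) ∧
      (∀ x ∈ p.support, x ∈ A → x = a₁) ∧ (∀ x ∈ p.support, x ∈ B → x = b₁) ∧
      (∀ x ∈ q.support, x ∈ A → x = a₂) ∧ (∀ x ∈ q.support, x ∈ B → x = b₂) := by
  obtain ⟨d, hd, e, he, hde⟩ := hB
  obtain ⟨s, hs, t, ht, p, q, hp, hq, hpq⟩ := hG.exists_fan hA d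
  obtain ⟨a, ha, had⟩ := hA.exists_ne d
  obtain ⟨r, hr⟩ := hG.exists_walk_avoiding had hde.symm
  obtain ⟨s, hs, t, ht, p, q, hp, hq, hpq⟩ := exists_disjoint_paths_of_fan ha hs ht hr hp hq hpq
  obtain ⟨a₁, ha₁, b₁, hb₁, p', hp', hpp, hpA, hpB⟩ := p.exists_isPath_between hs he
  obtain ⟨a₂, ha₂, b₂, hb₂, q', hq', hqq, hqA, hqB⟩ := q.exists_isPath_between ht hd
  exact ⟨a₁, ha₁, a₂, ha₂, b₁, hb₁, b₂, hb₂, p', q', hp', hq',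
    fun x hx hx' => hpq x (hpp hx) (hqq hx'), hpA, hpB, hqA, hqB⟩

lemma Walk.IsCycle.nontrivial_support {v : V} {c : G.Walk v v} (hc : c.IsCycle) :
    {x | x ∈ c.support}.Nontrivial :=
  ⟨v, c.start_mem_support, c.snd, c.getVert_mem_support 1, (c.adj_snd hc.not_nil).ne⟩

lemma IsLongestCycle.exists_mem_support_of_isVertexConnected (hG : G.IsVertexConnected 2)
    {v w : V} {c : G.Walk v v} {d : G.Walk w w} (hc : IsLongestCycle c) (hd : IsLongestCycle d) :
    ∃ x, x ∈ c.support ∧ x ∈ d.support := by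
  by_contra! hdisj
  obtain ⟨a₁, ha₁, a₂, ha₂, b₁, hb₁, b₂, hb₂, p, q, hp, hq, hpq, hpA, hpB, hqA, hqB⟩ :=
    hG.exists_disjoint_paths hc.1.nontrivial_support hd.1.nontrivial_support
  have ha : a₁ ≠ a₂ := fun h => hpq a₁ p.start_mem_support (h ▸ q.start_mem_support)
  have hb : b₂ ≠ b₁ := fun h => hpq b₁ p.end_mem_support (h ▸ q.end_mem_support)
  obtain ⟨c', hc', hcc, hlc⟩ := hc.1.exists_long_isPath_between ha₁ ha₂ ha
  obtain ⟨d', hd', hdd, hld⟩ := hd.1.exists_long_isPath_between hb₂ hb₁ hb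
  have h1 : (c'.append q).IsPath := hc'.append hq fun z hz hz' => hqA z hz' (hcc hz)
  have h2 : (d'.append p.reverse).IsPath := hd'.append hp.reverse fun z hz hz' =>
    hpB z (by simpa using hz') (hdd hz)
  have hp0 : 0 < p.length :=
    not_nil_iff_lt_length.mp (not_nil_of_ne fun h => hdisj a₁ ha₁ (h ▸ hb₁))
  have hq0 : 0 < q.length :=
    not_nil_iff_lt_length.mp (not_nil_of_ne fun h => hdisj a₂ ha₂ (h ▸ hb₂))
  have hc0 := hc.1.three_le_length
  -- The longer arcs of both cycles, closed up by the two disjoint paths, give a cycle that is too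
  -- long.
  have hcyc : ((c'.append q).append (d'.append p.reverse)).IsCycle := by
    refine h1.isCycle_append h2 (fun z hz hz' => ?_) (Or.inl (by rw [length_append]; omega))
    have n1 := h1.support_nodup
    have n2 := h2.support_nodup
    rw [← cons_tail_support, List.nodup_cons] at n1 n2
    have e1 : z ≠ a₁ := fun h => n1.1 (h ▸ hz)
    have e2 : z ≠ b₂ := fun h => n2.1 (h ▸ hz')
    have m1 := (mem_support_append_iff ..).mp (List.mem_of_mem_tail hz)
    have m2 := (mem_support_append_iff ..).mp (List.mem_of_mem_tail hz')
    rw [support_reverse, List.mem_reverse] at m2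
    rcases m1 with m1 | m1 <;> rcases m2 with m2 | m2
    · exact hdisj z (hcc m1) (hdd m2)
    · exact e1 (hpA z m2 (hcc m1))
    · exact e2 (hqB z m1 (hdd m2))
    · exact hpq z m2 m1
  have hl1 := hc.2 _ _ hcyc
  have hl2 := hd.2 _ _ hcyc
  simp only [length_append, length_reverse] at hl1 hl2
  omega

/-! ### Arcs of the circle as intervals of the line -/

lemma coe_mem_openArc {a b t : ℝ} :
    (t : UnitAddCircle) ∈ openArc a b ↔ ∃ n : ℤ, a < t + n ∧ t + n < b := by
  constructor
  · rintro ⟨s, hs, hst⟩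
    have h0 : ((s - t : ℝ) : UnitAddCircle) = 0 := by
      rw [AddCircle.coe_sub]
      exact sub_eq_zero.mpr hst
    obtain ⟨n, hn⟩ := (AddCircle.coe_eq_zero_iff (1 : ℝ)).mp h0
    have hs' : t + n = s := by
      rw [zsmul_eq_mul, mul_one] at hn
      linarith
    exact ⟨n, hs' ▸ hs.1, hs' ▸ hs.2⟩
  · rintro ⟨n, h₁, h₂⟩
    refine ⟨t + n, ⟨h₁, h₂⟩, ?_⟩
    have h0 : ((n : ℝ) : UnitAddCircle) = 0 :=
      (AddCircle.coe_eq_zero_iff (1 : ℝ)).mpr ⟨n, by simp⟩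
    change ((t + n : ℝ) : UnitAddCircle) = t
    rw [AddCircle.coe_add, h0, add_zero]

lemma openArc_add_intCast (a b : ℝ) (m : ℤ) : openArc (a + m) (b + m) = openArc a b := by
  ext x
  obtain ⟨t, rfl⟩ := QuotientAddGroup.mk_surjective x
  refine coe_mem_openArc.trans (Iff.trans ?_ coe_mem_openArc.symm)
  constructor
  · rintro ⟨n, h₁, h₂⟩
    exact ⟨n - m, by push_cast; linarith, by push_cast; linarith⟩
  · rintro ⟨n, h₁, h₂⟩
    exact ⟨n + m, by push_cast; linarith, by push_cast; linarith⟩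

/-- On `[β, α + 1]`, the complement of `(α, β)`, an arc that starts in `[α, α + 1)` and is at most
as long as `(α, β)` is an interval of the line. -/
lemma coe_mem_openArc_iff_mem_Ioo {a b t α β : ℝ} (ha : α ≤ a) (hab : b - a ≤ β - α)
    (ha' : a < α + 1) (ht : t ∈ Set.Icc β (α + 1)) :
    (t : UnitAddCircle) ∈ openArc a b ↔ t ∈ Set.Ioo a b := by
  rw [coe_mem_openArc]
  refine ⟨fun ⟨n, h₁, h₂⟩ => ?_, fun h => ⟨0, by simpa using h.1, by simpa using h.2⟩⟩
  -- Here `t + n < b < β + 1` and `t + n > a ≥ α`.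
  have hn1 : (n : ℝ) < 1 := by linarith [ht.1]
  have hn2 : (-1 : ℝ) < n := by linarith [ht.2]
  have hn : n = 0 := by
    have : n < 1 := by exact_mod_cast hn1
    have : -1 < n := by exact_mod_cast hn2
    omega
  subst hn
  exact ⟨by simpa using h₁, by simpa using h₂⟩

/-! ### The transversal of three vertices -/

lemma Walk.IsSaturated.mem_support_of_mem_openArc {a b : V → ℝ}
    (hG : ∀ v w, G.Adj v w ↔ v ≠ w ∧ (openArc (a v) (b v) ∩ openArc (a w) (b w)).Nonempty)
    {v w : V} {p : G.Walk v w} (hp : p.IsSaturated) {d : G.Dart} (hd : d ∈ p.darts)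
    {t : UnitAddCircle} (h₁ : t ∈ openArc (a d.fst) (b d.fst))
    (h₂ : t ∈ openArc (a d.snd) (b d.snd)) {x : V} (hx : t ∈ openArc (a x) (b x)) :
    x ∈ p.support := by
  by_cases e₁ : x = d.fst
  · exact e₁ ▸ dart_fst_mem_support_of_mem_darts p hd
  by_cases e₂ : x = d.snd
  · exact e₂ ▸ dart_snd_mem_support_of_mem_darts p hd
  exact hp d hd x ((hG _ _).mpr ⟨e₁, t, hx, h₁⟩) ((hG _ _).mpr ⟨e₂, t, hx, h₂⟩)

/-- If the arcs start within one turn from the start of the longest arc `u`, then `u` and two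
further vertices meet every member of a pairwise intersecting family of saturated walks. -/
lemma exists_transversal_of_normalized [Finite V] {a b : V → ℝ} {u : V}
    (hG : ∀ v w, G.Adj v w ↔ v ≠ w ∧ (openArc (a v) (b v) ∩ openArc (a w) (b w)).Nonempty)
    (ha : ∀ v, a u ≤ a v) (ha' : ∀ v, a v < a u + 1) (hab : ∀ v, b v - a v ≤ b u - a u)
    {𝓟 : Set (Set V)}
    (h𝓟 : ∀ P ∈ 𝓟, ∃ (v w : V) (p : G.Walk v w), ¬ p.Nil ∧ p.IsSaturated ∧ {x | x ∈ p.support} = P)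
    (hinter : ∀ P ∈ 𝓟, ∀ Q ∈ 𝓟, (P ∩ Q).Nonempty) :
    ∃ S : Set V, S.encard ≤ 3 ∧ ∀ P ∈ 𝓟, (S ∩ P).Nonempty := by
  classical
  let I : V → Set ℝ := fun v => Set.Icc (b u) (a u + 1) ∩ Set.Ioo (a v) (b v)
  have hI : ∀ v, IsPreconnected (I v) := fun v =>
    (Set.ordConnected_Icc.inter Set.ordConnected_Ioo).isPreconnected
  have hdart : ∀ {v w : V} {p : G.Walk v w}, p.IsSaturated → u ∉ p.support → ∀ d ∈ p.darts,
      (I d.fst ∩ I d.snd).Nonempty := by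
    intro v w p hp hu d hd
    obtain ⟨-, x, h₁, h₂⟩ := (hG _ _).mp d.adj
    have hx : x ∉ openArc (a u) (b u) := fun hx =>
      hu (hp.mem_support_of_mem_openArc hG hd h₁ h₂ hx)
    obtain ⟨t, ht, rfl⟩ :
        x ∈ ((↑) : ℝ → UnitAddCircle) '' Set.Ioc (a u) (a u + 1) := by
      rw [AddCircle.coe_image_Ioc_eq]
      trivial
    have ht' : t ∈ Set.Icc (b u) (a u + 1) := by
      refine ⟨?_, ht.2⟩
      by_contra! h
      exact hx ⟨t, ⟨ht.1, h⟩, rfl⟩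
    exact ⟨t, ⟨ht', (coe_mem_openArc_iff_mem_Ioo (ha _) (hab _) (ha' _) ht').mp h₁⟩,
      ⟨ht', (coe_mem_openArc_iff_mem_Ioo (ha _) (hab _) (ha' _) ht').mp h₂⟩⟩
  let 𝓠 : Set (Set V) := {P ∈ 𝓟 | u ∉ P}
  have h𝓠 : 𝓠.Finite := Set.toFinite _
  rcases 𝓠.eq_empty_or_nonempty with hemp | ⟨P₀, hP₀⟩
  · refine ⟨{u}, by simp, fun P hP => ⟨u, rfl, ?_⟩⟩
    by_contra hu
    exact (Set.eq_empty_iff_forall_notMem.mp hemp P) ⟨hP, hu⟩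
  have hmem : ∀ P ∈ 𝓠, ∀ x ∈ P, (I x).Nonempty := by
    rintro P ⟨hP, hu⟩ x hx
    obtain ⟨v, w, p, hn, hp, rfl⟩ := h𝓟 P hP
    obtain ⟨d, hd, hxd⟩ := exists_mem_darts_of_mem_support hn hx
    obtain ⟨t, ht₁, ht₂⟩ := hdart hp hu d hd
    rcases hxd with rfl | rfl
    · exact ⟨t, ht₁⟩
    · exact ⟨t, ht₂⟩
  -- In dimension one, Helly's theorem only asks for subfamilies of at most two sets.
  obtain ⟨t, ht⟩ : (⋂ P ∈ h𝓠.toFinset, ⋃ x ∈ P, I x).Nonempty := by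
    apply Convex.helly_theorem' (𝕜 := ℝ)
    · intro P hP
      obtain ⟨hP, hu⟩ := h𝓠.mem_toFinset.mp hP
      obtain ⟨v, w, p, hn, hp, rfl⟩ := h𝓟 P hP
      exact Real.convex_iff_isPreconnected.mpr
        (iUnion_support_isPreconnected I p hI (hdart hp hu))
    · intro 𝓡 h𝓡 hcard
      have hcard : 𝓡.card ≤ 2 := by simpa using hcard
      have hpair : ∀ P ∈ 𝓠, ∀ Q ∈ 𝓠, ((⋃ x ∈ P, I x) ∩ ⋃ x ∈ Q, I x).Nonempty := by
        intro P hP Q hQ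
        obtain ⟨x, hxP, hxQ⟩ := hinter P hP.1 Q hQ.1
        obtain ⟨t, ht⟩ := hmem P hP x hxP
        exact ⟨t, Set.mem_biUnion hxP ht, Set.mem_biUnion hxQ ht⟩
      have h𝓡' : ∀ P ∈ 𝓡, P ∈ 𝓠 := fun P hP => h𝓠.mem_toFinset.mp (h𝓡 hP)
      interval_cases hc : 𝓡.card
      · rw [Finset.card_eq_zero] at hc
        simp [hc]
      · obtain ⟨P, rfl⟩ := Finset.card_eq_one.mp hc
        simpa using hpair P (h𝓡' P (by simp)) P (h𝓡' P (by simp))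
      · obtain ⟨P, Q, -, rfl⟩ := Finset.card_eq_two.mp hc
        simpa using hpair P (h𝓡' P (by simp)) Q (h𝓡' Q (by simp))
  have ht' : ∀ P ∈ 𝓠, ∃ x ∈ P, t ∈ I x := fun P hP => by
    simpa using Set.mem_iInter₂.mp ht P (h𝓠.mem_toFinset.mpr hP)
  have hT : {x | t ∈ I x}.Nonempty := by
    obtain ⟨x, -, hx⟩ := ht' P₀ hP₀
    exact ⟨x, hx⟩
  obtain ⟨y, hy, hymin⟩ := Set.exists_min_image _ a (Set.toFinite _) hT
  obtain ⟨z, hz, hzmax⟩ := Set.exists_max_image _ b (Set.toFinite _) hT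
  refine ⟨{u, y, z}, Set.encard_insert_le .. |>.trans ?_, fun P hP => ?_⟩
  · calc ({y, z} : Set V).encard + 1 ≤ 2 + 1 := by gcongr; exact (Set.encard_insert_le _ _).trans (by simp [one_add_one_eq_two])
      _ = 3 := by norm_num
  by_cases hu : u ∈ P
  · exact ⟨u, by simp, hu⟩
  obtain ⟨x, hxP, hx⟩ := ht' P ⟨hP, hu⟩
  obtain ⟨v, w, p, hn, hp, rfl⟩ := h𝓟 P hP
  obtain ⟨d, hd, hxd⟩ := exists_mem_darts_of_mem_support hn hxP
  -- An arc through `s` meets both ends of the edge `d`, so by saturation its vertex is on `p`. It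
  -- remains to see that `y` or `z` contains `s`, according to the side of `t`.
  obtain ⟨s, hs₁, hs₂⟩ := hdart hp hu d hd
  have hsx : s ∈ I x := by
    rcases hxd with rfl | rfl
    · exact hs₁
    · exact hs₂
  have hs : ∀ {c}, s ∈ Set.Ioo (a c) (b c) → c ∈ p.support := fun {c} hc =>
    hp.mem_support_of_mem_openArc hG hd ⟨s, hs₁.2, rfl⟩ ⟨s, hs₂.2, rfl⟩ ⟨s, hc, rfl⟩
  rcases le_total s t with hst | hst
  · exact ⟨y, by simp, hs ⟨(hymin x hx).trans_lt hsx.2.1, hst.trans_lt hy.2.2⟩⟩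
  · exact ⟨z, by simp, hs ⟨hz.2.1.trans_le hst, hsx.2.2.trans_le (hzmax x hx)⟩⟩

lemma IsCircularArc.exists_transversal [Finite V] (hG : G.IsCircularArc) {𝓟 : Set (Set V)}
    (h𝓟 : ∀ P ∈ 𝓟, ∃ (v w : V) (p : G.Walk v w), ¬ p.Nil ∧ p.IsSaturated ∧ {x | x ∈ p.support} = P)
    (hinter : ∀ P ∈ 𝓟, ∀ Q ∈ 𝓟, (P ∩ Q).Nonempty) :
    ∃ S : Set V, S.encard ≤ 3 ∧ ∀ P ∈ 𝓟, (S ∩ P).Nonempty := by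
  obtain ⟨a, b, -, hG⟩ := hG
  rcases isEmpty_or_nonempty V with hV | hV
  · refine ⟨∅, by simp, fun P hP => ?_⟩
    obtain ⟨v, -⟩ := h𝓟 P hP
    exact isEmptyElim v
  obtain ⟨u, hu⟩ := Finite.exists_max fun v => b v - a v
  -- Whole turns bring every starting point into `[a u, a u + 1)`.
  let m : V → ℤ := fun v => -⌊a v - a u⌋
  have hmu : m u = 0 := by simp [m]
  have hm : ∀ v, a u ≤ a v + m v ∧ a v + m v < a u + 1 := fun v => by
    have h₁ := Int.floor_le (a v - a u)
    have h₂ := Int.lt_floor_add_one (a v - a u)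
    simp only [m, Int.cast_neg]
    constructor <;> linarith
  refine exists_transversal_of_normalized (a := fun v => a v + m v) (b := fun v => b v + m v)
    (u := u) ?_ ?_ ?_ ?_ h𝓟 hinter
  · simpa only [openArc_add_intCast] using hG
  · intro v
    simpa [hmu] using (hm v).1
  · intro v
    simpa [hmu] using (hm v).2
  · intro v
    simpa using hu v

end SimpleGraph

theorem theorem6 {V : Type*} [Finite V] (G : SimpleGraph V) (hG : G.IsCircularArc) :
    (G.Connected → G.lpt ≤ 3) ∧ (G.IsVertexConnected 2 → G.lct ≤ 3) := by
  constructor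
  · intro hc
    -- On a single vertex the longest path has no edge, so the interval argument does not apply.
    rcases subsingleton_or_nontrivial V with hV | hV
    · refine iInf₂_le_of_le Set.univ (fun v w p _ => ⟨v, trivial, p.start_mem_support⟩) ?_
      exact (Set.encard_le_one_iff.mpr fun x y _ _ => Subsingleton.elim x y).trans (by norm_num)
    obtain ⟨S, hS, hSP⟩ := hG.exists_transversal
      (𝓟 := {P | ∃ (v w : V) (p : G.Walk v w), SimpleGraph.IsLongestPath p ∧ {x | x ∈ p.support} = P}) (by
        rintro P ⟨v, w, p, hp, rfl⟩
        refine ⟨v, w, p, fun hn => ?_, hp.isSaturated, rfl⟩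
        obtain ⟨y, hy⟩ := hc.preconnected.exists_adj_of_nontrivial v
        have := hp.2 _ _ (.cons hy .nil) (by simp [hy.ne])
        rw [SimpleGraph.Walk.length_eq_zero_iff.mpr hn] at this
        simp at this) (by
        rintro _ ⟨v, w, p, hp, rfl⟩ _ ⟨v', w', q, hq, rfl⟩
        exact hp.exists_mem_support_of_connected hc hq)
    exact iInf₂_le_of_le S (fun v w p hp => hSP _ ⟨v, w, p, hp, rfl⟩) hS
  · intro hc
    obtain ⟨S, hS, hSP⟩ := hG.exists_transversal
      (𝓟 := {P | ∃ (v : V) (c : G.Walk v v), SimpleGraph.IsLongestCycle c ∧ {x | x ∈ c.support} = P}) (by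
        rintro P ⟨v, c, h, rfl⟩
        exact ⟨v, v, c, h.1.not_nil, h.isSaturated, rfl⟩) (by
        rintro _ ⟨v, c, h, rfl⟩ _ ⟨w, d, h', rfl⟩
        exact h.exists_mem_support_of_isVertexConnected hc h')
    exact iInf₂_le_of_le S (fun v c h => hSP _ ⟨v, c, h, rfl⟩) hS
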